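/- A function $h\colon\mathbb C\setminus\mathbb R\to\mathbb C$ is called a Herglotz function if it is holomorphic and satisfies $\frac{\operatorname{Im} h(z)}{\operatorname{Im} z}\ge 0$ and $\overline{h(z)}=h(\bar z)$ for all $z\in\mathbb C\setminus\mathbb R$. A function $q\colon\mathbb C\setminus\mathbb R\to\mathbb C$ is called quasi-Herglotz if there are Herglotz functions $h_1,h_2,h_3,h_4$ such that $q(z)=(h_1(z)-h_2(z))+i\,(h_3(z)-h_4(z))$ for all $z\in\mathbb C\setminus\mathbb R$. Theorem (integral representation of quasi-Herglotz functions). A function $q\colon\mathbb C\setminus\mathbb R\to\mathbb C$ is a quasi-Herglotz function if and only if there exist $a,b\in\mathbb C$ and a complex Borel measure $\nu$ on $\mathbb R$ such that $$q(z)=a+bz+\frac1\pi\int_{\mathbb R}\frac{1+tz}{t-z}\,d\nu(t)\qquad\text{for every } z\in\mathbb C\setminus\mathbb R.$$ Furthermore, this representation is unique: if $(a,b,\nu)$ and $(a',b',\nu')$ both represent $q$ in this way on $\mathbb C\setminus\mathbb R$, then $a=a'$, $b=b'$ and $\nu=\nu'$. -/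

import Mathlib

open MeasureTheory

/-- `h` is a Herglotz function: holomorphic on `ℂ ∖ ℝ`, with `Im h(z) / Im z ≥ 0` and
`conj (h z) = h (conj z)` there. A function on `ℂ ∖ ℝ` is represented by a function `ℂ → ℂ` of which
only the values at non-real points matter. -/
def IsHerglotz (h : ℂ → ℂ) : Prop :=
  DifferentiableOn ℂ h {z : ℂ | z.im ≠ 0} ∧
    ∀ z : ℂ, z.im ≠ 0 →
      0 ≤ (h z).im / z.im ∧ (starRingEnd ℂ) (h z) = h ((starRingEnd ℂ) z)

/-- `q` is a quasi-Herglotz function: `q = (h₁ - h₂) + i (h₃ - h₄)` on `ℂ ∖ ℝ` with Herglotz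
functions `h₁, h₂, h₃, h₄`. -/
def IsQuasiHerglotz (q : ℂ → ℂ) : Prop :=
  ∃ h₁ h₂ h₃ h₄ : ℂ → ℂ, IsHerglotz h₁ ∧ IsHerglotz h₂ ∧ IsHerglotz h₃ ∧ IsHerglotz h₄ ∧
    ∀ z : ℂ, z.im ≠ 0 → q z = (h₁ z - h₂ z) + Complex.I * (h₃ z - h₄ z)

/-- The kernel `(1 + t z) / (t - z)`. -/
noncomputable def herglotzKernel (z : ℂ) (t : ℝ) : ℂ :=
  (1 + (t : ℂ) * z) / ((t : ℂ) - z)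

/-- The integral `∫ f dν` of a complex function against a complex measure: Mathlib's integral
against a vector measure, for the pairing `ℂ × ℂ → ℂ` given by multiplication. -/
noncomputable def complexIntegral (f : ℝ → ℂ) (ν : ComplexMeasure ℝ) : ℂ :=
  ν.integral f (ContinuousLinearMap.mul ℝ ℂ)

/-- `q(z) = a + b z + (1/π) ∫ (1 + t z)/(t - z) dν(t)` for every `z ∈ ℂ ∖ ℝ`. -/
def HasIntegralRep (q : ℂ → ℂ) (a b : ℂ) (ν : ComplexMeasure ℝ) : Prop :=
  ∀ z : ℂ, z.im ≠ 0 →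
    q z = a + b * z + (1 / (Real.pi : ℂ)) * complexIntegral (herglotzKernel z) ν

/-- A complex measure has finite total variation. -/
theorem isFiniteMeasure_variation (ν : ComplexMeasure ℝ) : IsFiniteMeasure ν.variation := by
  let R := (ComplexMeasure.re ν).variation
  let J := (ComplexMeasure.im ν).variation
  have hR : IsFiniteMeasure R := by
    change IsFiniteMeasure (ComplexMeasure.re ν).variation
    rw [← SignedMeasure.totalVariation_eq_variation, SignedMeasure.totalVariation]
    infer_instance
  have hJ : IsFiniteMeasure J := by
    change IsFiniteMeasure (ComplexMeasure.im ν).variation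
    rw [← SignedMeasure.totalVariation_eq_variation, SignedMeasure.totalVariation]
    infer_instance
  have hle : ν.variation ≤ R + J := by
    refine VectorMeasure.variation_le_of_forall_enorm_le (fun s _ => ?_)
    have h1 : ‖ν s‖ₑ ≤ ‖(ν s).re‖ₑ + ‖(ν s).im‖ₑ := by
      rw [← ofReal_norm, ← ofReal_norm, ← ofReal_norm,
        ← ENNReal.ofReal_add (norm_nonneg _) (norm_nonneg _)]
      exact ENNReal.ofReal_le_ofReal (Complex.norm_le_abs_re_add_abs_im (ν s))
    refine h1.trans ?_
    rw [Measure.add_apply]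
    exact add_le_add ((ComplexMeasure.re ν).enorm_measure_le_variation s)
      ((ComplexMeasure.im ν).enorm_measure_le_variation s)
  exact isFiniteMeasure_of_le _ hle

/-- The kernel is integrable against every complex measure, so that the integral in
`HasIntegralRep` never takes a default value. -/
theorem integrable_herglotzKernel (ν : ComplexMeasure ℝ) {z : ℂ} (hz : z.im ≠ 0) :
    ν.Integrable (herglotzKernel z) := by
  have := isFiniteMeasure_variation ν
  have hne : ∀ t : ℝ, (t : ℂ) - z ≠ 0 := fun t h => hz (by
    have := congrArg Complex.im h
    simpa using this)
  have hc : Continuous (herglotzKernel z) := by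
    unfold herglotzKernel
    exact Continuous.div (by fun_prop) (by fun_prop) hne
  refine Integrable.of_bound hc.aestronglyMeasurable (‖z‖ + ‖1 + z ^ 2‖ / |z.im|)
    (Filter.Eventually.of_forall fun t => ?_)
  have h1 : herglotzKernel z t = z + (1 + z ^ 2) / ((t : ℂ) - z) := by
    have := hne t
    unfold herglotzKernel
    field_simp
    ring
  have h2 : |z.im| ≤ ‖(t : ℂ) - z‖ := by
    simpa using Complex.abs_im_le_norm ((t : ℂ) - z)
  rw [h1]
  refine (norm_add_le _ _).trans ?_
  rw [norm_div]
  have : 0 < |z.im| := abs_pos.mpr hz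
  gcongr

/-! Everything reduces to positive measures, since the Jordan decompositions of the real and
imaginary parts write ν = (σ₁ - σ₂) + i (σ₃ - σ₄). The kernel has imaginary part of the sign of Im
z, so each σₖ yields a Herglotz function (`isHerglotz_of_integralRep`); this settles the "if"
direction.

For "only if", the Cayley transform turns -i h into a function on the disk with nonnegative real
part. The Schwarz formula on smaller disks, with weak compactness of measures of fixed mass,
represents it by a measure on the circle (`exists_measure_eq_integral_herglotzRieszKernel`). Back on
the line, an atom at the boundary point 1 becomes the term b z and the rest becomes σ.

For uniqueness, comparing q(z) with the conjugate of q at conj z separates real from imaginary data.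
Evaluation at i disposes of the constant, and Stieltjes inversion
(`MeasureTheory.Measure.ext_of_stieltjes_eq`) recovers the measure. -/

/-- The complex measure `c • σ` attached to a finite positive measure `σ` and a scalar `c`. -/
noncomputable def MeasureTheory.Measure.scaledComplexMeasure {X : Type*} [MeasurableSpace X]
    (σ : Measure X) [IsFiniteMeasure σ] (c : ℂ) : ComplexMeasure X :=
  σ.toSignedMeasure.mapRange ((ContinuousLinearMap.toSpanSingleton ℝ c).toLinearMap.toAddMonoidHom)
    (ContinuousLinearMap.toSpanSingleton ℝ c).continuous

/-! ### Complex measures as combinations of four finite positive measures -/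

section ScaledComplexMeasure

variable {X : Type*} [MeasurableSpace X]

theorem scaledComplexMeasure_apply (σ : Measure X) [IsFiniteMeasure σ] (c : ℂ) {s : Set X}
    (hs : MeasurableSet s) : σ.scaledComplexMeasure c s = σ.real s * c := by
  simp [Measure.scaledComplexMeasure, VectorMeasure.mapRange_apply,
    Measure.toSignedMeasure_apply_measurable hs]

theorem variation_scaledComplexMeasure_le (σ : Measure X) [IsFiniteMeasure σ] (c : ℂ) :
    (σ.scaledComplexMeasure c).variation ≤ ‖c‖₊ • σ := by
  refine VectorMeasure.variation_le_of_forall_enorm_le fun s hs => ?_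
  rw [scaledComplexMeasure_apply σ c hs, enorm_mul, mul_comm, Measure.smul_apply]
  refine le_of_eq ?_
  have : ‖((σ.real s : ℝ) : ℂ)‖ₑ = σ s := by
    rw [← ofReal_norm, Complex.norm_real, Real.norm_of_nonneg measureReal_nonneg,
      ofReal_measureReal]
  rw [this]
  rfl

theorem integrable_scaledComplexMeasure {σ : Measure X} [IsFiniteMeasure σ] {f : X → ℂ}
    (hf : Integrable f σ) (c : ℂ) : (σ.scaledComplexMeasure c).Integrable f :=
  (hf.smul_measure_nnreal (c := ‖c‖₊)).mono_measure (variation_scaledComplexMeasure_le σ c)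

/-- The variation is at most ‖c‖ σ, so the vector-measure integral may be computed as a `setToFun`
over σ itself. Both sides are then continuous and additive in f ∈ L¹(σ), and they agree on
indicators. -/
theorem integral_scaledComplexMeasure {σ : Measure X} [IsFiniteMeasure σ] {f : X → ℂ}
    (hf : Integrable f σ) (c : ℂ) :
    (σ.scaledComplexMeasure c).integral f (ContinuousLinearMap.mul ℝ ℂ) = c * ∫ x, f x ∂σ := by
  have hT : DominatedFinMeasAdditive σ
      ((σ.scaledComplexMeasure c).transpose (ContinuousLinearMap.mul ℝ ℂ)) ‖c‖ := by
    rw [transpose_eq_cbmApplyMeasure]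
    refine ⟨fun s t hs ht _ _ hst => cbmApplyMeasure_union _ _ hs ht hst, fun s hs _ => ?_⟩
    refine (norm_cbmApplyMeasure_le _ _ s).trans ?_
    rw [scaledComplexMeasure_apply σ c hs, ContinuousLinearMap.opNorm_mul, one_mul, norm_mul,
      Complex.norm_real, Real.norm_of_nonneg measureReal_nonneg, mul_comm]
  have hset : (σ.scaledComplexMeasure c).integral f (ContinuousLinearMap.mul ℝ ℂ) =
      setToFun σ _ hT f := by
    refine setToFun_congr_measure_of_integrable (μ := σ) (c' := ‖c‖₊) (by simp) ?_ _ _ f hf |>.symm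
    exact variation_scaledComplexMeasure_le σ c
  rw [hset]
  clear hset
  refine Integrable.induction (μ := σ) (fun f => setToFun σ _ hT f = c * ∫ x, f x ∂σ)
    (fun z s hs hfs => ?_) (fun f g _ hf hg ihf ihg => ?_)
    (isClosed_eq (continuous_setToFun _) (continuous_const.mul continuous_integral))
    (fun f g h _ ih => ?_) hf
  · rw [setToFun_indicator_const _ hs (measure_ne_top _ _), integral_indicator_const _ hs,
      transpose_eq_cbmApplyMeasure, cbmApplyMeasure_apply, ContinuousLinearMap.mul_apply',
      scaledComplexMeasure_apply σ c hs, Complex.real_smul]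
    ring
  · rw [setToFun_add _ hf hg, ihf, ihg, integral_add' hf hg, mul_add]
  · rw [← setToFun_congr_ae _ h, ih, integral_congr_ae h]

/-- The complex measure `(σ₁ - σ₂) + i (σ₃ - σ₄)`. -/
noncomputable def complexMeasureOfFour (σ₁ σ₂ σ₃ σ₄ : Measure X) [IsFiniteMeasure σ₁]
    [IsFiniteMeasure σ₂] [IsFiniteMeasure σ₃] [IsFiniteMeasure σ₄] : ComplexMeasure X :=
  (σ₁.toSignedMeasure - σ₂.toSignedMeasure).toComplexMeasure
    (σ₃.toSignedMeasure - σ₄.toSignedMeasure)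

theorem complexMeasureOfFour_eq_sum_scaledComplexMeasure (σ₁ σ₂ σ₃ σ₄ : Measure X)
    [IsFiniteMeasure σ₁] [IsFiniteMeasure σ₂] [IsFiniteMeasure σ₃] [IsFiniteMeasure σ₄] :
    complexMeasureOfFour σ₁ σ₂ σ₃ σ₄ =
      (σ₁.scaledComplexMeasure 1 - σ₂.scaledComplexMeasure 1) +
        (σ₃.scaledComplexMeasure Complex.I - σ₄.scaledComplexMeasure Complex.I) := by
  ext s hs
  rw [complexMeasureOfFour, SignedMeasure.toComplexMeasure_apply]
  simp only [add_apply, sub_apply,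
    scaledComplexMeasure_apply _ _ hs, Measure.toSignedMeasure_apply_measurable hs]
  apply Complex.ext <;> simp

theorem exists_eq_complexMeasureOfFour (ν : ComplexMeasure X) :
    ∃ (σ₁ σ₂ σ₃ σ₄ : Measure X) (_ : IsFiniteMeasure σ₁) (_ : IsFiniteMeasure σ₂)
      (_ : IsFiniteMeasure σ₃) (_ : IsFiniteMeasure σ₄),
      ν = complexMeasureOfFour σ₁ σ₂ σ₃ σ₄ := by
  refine ⟨(ComplexMeasure.re ν).toJordanDecomposition.posPart,
    (ComplexMeasure.re ν).toJordanDecomposition.negPart,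
    (ComplexMeasure.im ν).toJordanDecomposition.posPart,
    (ComplexMeasure.im ν).toJordanDecomposition.negPart,
    inferInstance, inferInstance, inferInstance, inferInstance, ?_⟩
  conv_lhs => rw [← ComplexMeasure.toComplexMeasure_to_signedMeasure ν,
    ← SignedMeasure.toSignedMeasure_toJordanDecomposition (ComplexMeasure.re ν),
    ← SignedMeasure.toSignedMeasure_toJordanDecomposition (ComplexMeasure.im ν)]
  rfl

end ScaledComplexMeasure

theorem complexIntegral_complexMeasureOfFour {σ₁ σ₂ σ₃ σ₄ : Measure ℝ}
    [IsFiniteMeasure σ₁] [IsFiniteMeasure σ₂] [IsFiniteMeasure σ₃] [IsFiniteMeasure σ₄]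
    {f : ℝ → ℂ} (h₁ : Integrable f σ₁) (h₂ : Integrable f σ₂) (h₃ : Integrable f σ₃)
    (h₄ : Integrable f σ₄) :
    complexIntegral f (complexMeasureOfFour σ₁ σ₂ σ₃ σ₄) =
      (∫ t, f t ∂σ₁ - ∫ t, f t ∂σ₂) + Complex.I * (∫ t, f t ∂σ₃ - ∫ t, f t ∂σ₄) := by
  rw [complexIntegral, complexMeasureOfFour_eq_sum_scaledComplexMeasure]
  have i₁ := integrable_scaledComplexMeasure h₁ 1
  have i₂ := integrable_scaledComplexMeasure h₂ 1
  have i₃ := integrable_scaledComplexMeasure h₃ Complex.I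
  have i₄ := integrable_scaledComplexMeasure h₄ Complex.I
  rw [VectorMeasure.integral_add_vectorMeasure (i₁.sub_vectorMeasure i₂) (i₃.sub_vectorMeasure i₄),
    VectorMeasure.integral_sub_vectorMeasure i₁ i₂, VectorMeasure.integral_sub_vectorMeasure i₃ i₄,
    integral_scaledComplexMeasure h₁, integral_scaledComplexMeasure h₂,
    integral_scaledComplexMeasure h₃, integral_scaledComplexMeasure h₄]
  ring

/-! ### The kernel, and integral representations as quasi-Herglotz functions -/

theorem ofReal_sub_ne_zero_of_im_ne_zero {z : ℂ} (hz : z.im ≠ 0) (t : ℝ) : (t : ℂ) - z ≠ 0 :=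
  fun h => hz (by simpa using congrArg Complex.im h)

/-- Isolating the t-dependence in the Cauchy kernel reduces integrability, holomorphy and uniqueness
to the Stieltjes transform of σ. -/
theorem herglotzKernel_eq_add_mul_inv {z : ℂ} (hz : z.im ≠ 0) (t : ℝ) :
    herglotzKernel z t = z + (1 + z ^ 2) * ((t : ℂ) - z)⁻¹ := by
  have := ofReal_sub_ne_zero_of_im_ne_zero hz t
  unfold herglotzKernel
  field_simp
  ring

theorem continuous_inv_ofReal_sub {z : ℂ} (hz : z.im ≠ 0) :
    Continuous fun t : ℝ => ((t : ℂ) - z)⁻¹ :=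
  Continuous.inv₀ (by fun_prop) (ofReal_sub_ne_zero_of_im_ne_zero hz)

theorem norm_inv_ofReal_sub_le {z : ℂ} (hz : z.im ≠ 0) (t : ℝ) :
    ‖((t : ℂ) - z)⁻¹‖ ≤ |z.im|⁻¹ := by
  rw [norm_inv]
  have h2 : |z.im| ≤ ‖(t : ℂ) - z‖ := by
    simpa using Complex.abs_im_le_norm ((t : ℂ) - z)
  have : 0 < |z.im| := abs_pos.mpr hz
  gcongr

theorem integrable_inv_ofReal_sub (σ : Measure ℝ) [IsFiniteMeasure σ] {z : ℂ} (hz : z.im ≠ 0) :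
    Integrable (fun t : ℝ => ((t : ℂ) - z)⁻¹) σ :=
  Integrable.of_bound (continuous_inv_ofReal_sub hz).aestronglyMeasurable |z.im|⁻¹
    (Filter.Eventually.of_forall (norm_inv_ofReal_sub_le hz))

theorem integrable_herglotzKernel_measure (σ : Measure ℝ) [IsFiniteMeasure σ] {z : ℂ}
    (hz : z.im ≠ 0) : Integrable (herglotzKernel z) σ := by
  rw [show herglotzKernel z = fun t : ℝ => z + (1 + z ^ 2) * ((t : ℂ) - z)⁻¹ from
    funext (herglotzKernel_eq_add_mul_inv hz)]
  exact (integrable_const z).add ((integrable_inv_ofReal_sub σ hz).const_mul _)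

theorem integral_herglotzKernel_eq (σ : Measure ℝ) [IsFiniteMeasure σ] {z : ℂ} (hz : z.im ≠ 0) :
    ∫ t, herglotzKernel z t ∂σ =
      z * σ.real Set.univ + (1 + z ^ 2) * ∫ t : ℝ, ((t : ℂ) - z)⁻¹ ∂σ := by
  simp_rw [herglotzKernel_eq_add_mul_inv hz]
  rw [integral_add (integrable_const z) ((integrable_inv_ofReal_sub σ hz).const_mul _),
    integral_const, integral_const_mul, Complex.real_smul, mul_comm z]

theorem conj_herglotzKernel (z : ℂ) (t : ℝ) :
    (starRingEnd ℂ) (herglotzKernel z t) = herglotzKernel ((starRingEnd ℂ) z) t := by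
  simp [herglotzKernel]

theorem conj_integral_herglotzKernel (σ : Measure ℝ) (z : ℂ) :
    (starRingEnd ℂ) (∫ t, herglotzKernel z t ∂σ) =
      ∫ t, herglotzKernel ((starRingEnd ℂ) z) t ∂σ := by
  rw [← integral_conj]
  simp_rw [conj_herglotzKernel]

theorem im_herglotzKernel (z : ℂ) (t : ℝ) :
    (herglotzKernel z t).im = z.im * ((1 + t ^ 2) / Complex.normSq ((t : ℂ) - z)) := by
  rw [herglotzKernel, Complex.div_im]
  simp
  ring

theorem differentiableOn_integral_inv_ofReal_sub (σ : Measure ℝ) [IsFiniteMeasure σ] :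
    DifferentiableOn ℂ (fun z : ℂ => ∫ t : ℝ, ((t : ℂ) - z)⁻¹ ∂σ) {z : ℂ | z.im ≠ 0} := by
  have h := (analyticOn_resolventTransform (μ := σ)).differentiableOn
  refine (h.mono fun z hz => ?_).congr fun z _ => ?_
  · rintro ⟨t, -, rfl⟩
    simp at hz
  · simp [resolventTransform_apply, resolvent]

theorem isHerglotz_of_integralRep (a : ℝ) {b : ℝ} (hb : 0 ≤ b) (σ : Measure ℝ)
    [IsFiniteMeasure σ] :
    IsHerglotz fun z => a + b * z + (1 / (Real.pi : ℂ)) * ∫ t, herglotzKernel z t ∂σ := by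
  refine ⟨?_, fun z hz => ⟨?_, ?_⟩⟩
  · have h : DifferentiableOn ℂ (fun z => (a : ℂ) + b * z + (1 / (Real.pi : ℂ)) *
        (z * σ.real Set.univ + (1 + z ^ 2) * ∫ t : ℝ, ((t : ℂ) - z)⁻¹ ∂σ)) {z : ℂ | z.im ≠ 0} := by
      have := differentiableOn_integral_inv_ofReal_sub σ
      fun_prop
    exact h.congr fun z hz => by rw [integral_herglotzKernel_eq σ hz]
  · have h1 : (∫ t, herglotzKernel z t ∂σ).im =
        z.im * ∫ t : ℝ, (1 + t ^ 2) / Complex.normSq ((t : ℂ) - z) ∂σ := by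
      rw [← integral_const_mul, ← Complex.imCLM_apply,
        ← Complex.imCLM.integral_comp_comm (integrable_herglotzKernel_measure σ hz)]
      simp [im_herglotzKernel]
    have h2 : 0 ≤ ∫ t : ℝ, (1 + t ^ 2) / Complex.normSq ((t : ℂ) - z) ∂σ :=
      integral_nonneg fun t => div_nonneg (by positivity) (Complex.normSq_nonneg _)
    have h3 : ((a : ℂ) + b * z + (1 / (Real.pi : ℂ)) * ∫ t, herglotzKernel z t ∂σ).im =
        (b + (1 / Real.pi) * ∫ t : ℝ, (1 + t ^ 2) / Complex.normSq ((t : ℂ) - z) ∂σ) * z.im := by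
      rw [show (1 / (Real.pi : ℂ)) = ((1 / Real.pi : ℝ) : ℂ) by push_cast; rfl]
      simp only [Complex.add_im, Complex.im_ofReal_mul, Complex.ofReal_im, h1]
      ring
    rw [h3, mul_div_assoc, div_self hz, mul_one]
    have := Real.pi_pos
    positivity
  · simp [conj_integral_herglotzKernel]

theorem HasIntegralRep.isQuasiHerglotz {q : ℂ → ℂ} {a b : ℂ} {ν : ComplexMeasure ℝ}
    (h : HasIntegralRep q a b ν) : IsQuasiHerglotz q := by
  obtain ⟨σ₁, σ₂, σ₃, σ₄, _, _, _, _, rfl⟩ := exists_eq_complexMeasureOfFour ν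
  -- Slopes must be nonnegative, so the real and imaginary parts of b are split into positive and
  -- negative parts; the constants need no splitting.
  refine ⟨_, _, _, _, isHerglotz_of_integralRep a.re (le_max_right b.re 0) σ₁,
    isHerglotz_of_integralRep 0 (le_max_right (-b.re) 0) σ₂,
    isHerglotz_of_integralRep a.im (le_max_right b.im 0) σ₃,
    isHerglotz_of_integralRep 0 (le_max_right (-b.im) 0) σ₄, fun z hz => ?_⟩
  have hmax (x : ℝ) : (x : ℂ) = (max x 0 : ℝ) - (max (-x) 0 : ℝ) := by
    rw [← Complex.ofReal_sub, max_zero_sub_max_neg_zero_eq_self]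
  have hint (σ : Measure ℝ) [IsFiniteMeasure σ] := integrable_herglotzKernel_measure σ hz
  rw [h z hz, complexIntegral_complexMeasureOfFour (hint _) (hint _) (hint _) (hint _)]
  conv_lhs => rw [← Complex.re_add_im a, ← Complex.re_add_im b, hmax b.re, hmax b.im]
  push_cast
  ring

/-! ### Stieltjes inversion -/

section StieltjesInversion

open Filter Topology BoundedContinuousFunction

/-- The right side is π times the Poisson kernel of the upper half plane, an approximate identity as
y → 0. -/
theorem im_inv_ofReal_sub {y : ℝ} (hy : 0 < y) (x t : ℝ) :
    (((t : ℂ) - (x + y * Complex.I))⁻¹).im = y⁻¹ * (1 + ((x - t) / y) ^ 2)⁻¹ := by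
  have : (0 : ℝ) < (t - x) ^ 2 + y ^ 2 := by positivity
  rw [Complex.inv_im]
  simp [Complex.normSq_apply]
  field_simp
  ring

theorem integrable_poissonKernel_line {y : ℝ} (hy : 0 < y) (t : ℝ) :
    Integrable fun x : ℝ => y⁻¹ * (1 + ((x - t) / y) ^ 2)⁻¹ :=
  (((integrable_inv_one_add_sq.comp_div hy.ne').comp_sub_right t)).const_mul _

theorem integral_mul_poissonKernel_line (g : ℝ → ℝ) {y : ℝ} (hy : 0 < y) (t : ℝ) :
    ∫ x : ℝ, g x * (y⁻¹ * (1 + ((x - t) / y) ^ 2)⁻¹) = ∫ s : ℝ, g (t + y * s) * (1 + s ^ 2)⁻¹ := by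
  have h1 := Measure.integral_comp_mul_left
    (fun u : ℝ => g (t + u) * (y⁻¹ * (1 + ((t + u - t) / y) ^ 2)⁻¹)) y
  rw [integral_add_left_eq_self (fun x : ℝ => g x * (y⁻¹ * (1 + ((x - t) / y) ^ 2)⁻¹)) t,
    abs_of_pos (inv_pos.2 hy), smul_eq_mul] at h1
  rw [← mul_right_inj' (inv_ne_zero hy.ne'), ← h1, ← integral_const_mul]
  refine integral_congr_ae (Eventually.of_forall fun s => ?_)
  simp only [add_sub_cancel_left, mul_div_cancel_left₀ _ hy.ne']
  ring

theorem integrable_prod_poissonKernel_line (σ : Measure ℝ) [IsFiniteMeasure σ] {y : ℝ}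
    (hy : 0 < y) :
    Integrable (fun p : ℝ × ℝ => y⁻¹ * (1 + ((p.2 - p.1) / y) ^ 2)⁻¹) (σ.prod volume) := by
  have hm : Measurable (fun p : ℝ × ℝ => y⁻¹ * (1 + ((p.2 - p.1) / y) ^ 2)⁻¹) := by fun_prop
  rw [integrable_prod_iff hm.aestronglyMeasurable]
  refine ⟨Eventually.of_forall fun t => integrable_poissonKernel_line hy t, ?_⟩
  refine (integrable_const Real.pi).congr (Eventually.of_forall fun t => ?_)
  have h := integral_mul_poissonKernel_line (fun _ => 1) hy t
  simp only [one_mul, integral_univ_inv_one_add_sq] at h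
  simp only [← h]
  refine integral_congr_ae (Eventually.of_forall fun s => ?_)
  exact (Real.norm_of_nonneg (by positivity)).symm

theorem integral_mul_im_stieltjes (σ : Measure ℝ) [IsFiniteMeasure σ] (f : ℝ →ᵇ ℝ) {y : ℝ}
    (hy : 0 < y) :
    ∫ x : ℝ, f x * (∫ t : ℝ, ((t : ℂ) - (x + y * Complex.I))⁻¹ ∂σ).im =
      ∫ t : ℝ, (∫ s : ℝ, f (t + y * s) * (1 + s ^ 2)⁻¹) ∂σ := by
  have h1 (x : ℝ) : f x * (∫ t : ℝ, ((t : ℂ) - (x + y * Complex.I))⁻¹ ∂σ).im =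
      ∫ t : ℝ, f x * (y⁻¹ * (1 + ((x - t) / y) ^ 2)⁻¹) ∂σ := by
    have hz : ((x : ℂ) + y * Complex.I).im ≠ 0 := by simpa using hy.ne'
    rw [integral_const_mul, ← Complex.imCLM_apply,
      ← Complex.imCLM.integral_comp_comm (integrable_inv_ofReal_sub σ hz)]
    simp only [Complex.imCLM_apply, im_inv_ofReal_sub hy]
  simp_rw [h1]
  have hint : Integrable (fun p : ℝ × ℝ => f p.2 * (y⁻¹ * (1 + ((p.2 - p.1) / y) ^ 2)⁻¹))
      (σ.prod volume) :=
    (integrable_prod_poissonKernel_line σ hy).bdd_mul (c := ‖f‖)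
      (f.continuous.comp continuous_snd).aestronglyMeasurable
      (Eventually.of_forall fun p => f.norm_coe_le_norm _)
  rw [← integral_integral_swap (f := fun t x => f x * (y⁻¹ * (1 + ((x - t) / y) ^ 2)⁻¹)) hint]
  simp_rw [integral_mul_poissonKernel_line f hy]

theorem norm_mul_inv_one_add_sq_le (f : ℝ →ᵇ ℝ) (x s : ℝ) :
    ‖f x * (1 + s ^ 2)⁻¹‖ ≤ ‖f‖ * (1 + s ^ 2)⁻¹ := by
  rw [norm_mul, Real.norm_of_nonneg (by positivity : (0 : ℝ) ≤ (1 + s ^ 2)⁻¹)]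
  gcongr
  exact f.norm_coe_le_norm _

theorem tendsto_integral_integral_poisson (σ : Measure ℝ) [IsFiniteMeasure σ] (f : ℝ →ᵇ ℝ) :
    Tendsto (fun y : ℝ => ∫ t : ℝ, (∫ s : ℝ, f (t + y * s) * (1 + s ^ 2)⁻¹) ∂σ) (𝓝[>] 0)
      (𝓝 (Real.pi * ∫ t, f t ∂σ)) := by
  have hb : Integrable (fun s : ℝ => ‖f‖ * (1 + s ^ 2)⁻¹) := integrable_inv_one_add_sq.const_mul _
  rw [← integral_const_mul]
  refine tendsto_integral_filter_of_dominated_convergence (fun _ => ‖f‖ * Real.pi)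
    (Eventually.of_forall fun y => ?_) (Eventually.of_forall fun y => Eventually.of_forall
      fun t => ?_) (integrable_const _) (Eventually.of_forall fun t => ?_)
  · refine AEStronglyMeasurable.integral_prod_right' (f := fun p : ℝ × ℝ =>
      f (p.1 + y * p.2) * (1 + p.2 ^ 2)⁻¹) (Measurable.aestronglyMeasurable ?_)
    have := f.continuous.measurable
    fun_prop
  · refine (norm_integral_le_of_norm_le hb (Eventually.of_forall fun s =>
      norm_mul_inv_one_add_sq_le f _ s)).trans_eq ?_
    rw [integral_const_mul, integral_univ_inv_one_add_sq]
  · rw [mul_comm, ← integral_univ_inv_one_add_sq, ← integral_const_mul]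
    refine tendsto_integral_filter_of_dominated_convergence _
      (Eventually.of_forall fun y => ?_) (Eventually.of_forall fun y => Eventually.of_forall
      fun s => norm_mul_inv_one_add_sq_le f _ s) hb (Eventually.of_forall fun s => ?_)
    · have := f.continuous.measurable
      exact Measurable.aestronglyMeasurable (by fun_prop)
    · have h : Continuous fun y : ℝ => f (t + y * s) * (1 + s ^ 2)⁻¹ := by fun_prop
      have := h.tendsto 0
      simp only [zero_mul, add_zero] at this
      exact this.mono_left nhdsWithin_le_nhds

/-- By Fubini, pairing the imaginary part on the line Im z = y with a bounded continuous f
integrates a Poisson smoothing of f against the measure. As y → 0 this tends to π ∫ f, and such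
integrals determine a finite measure. -/
theorem MeasureTheory.Measure.ext_of_stieltjes_eq {σ τ : Measure ℝ} [IsFiniteMeasure σ] [IsFiniteMeasure τ]
    (h : ∀ z : ℂ, 0 < z.im → ∫ t : ℝ, ((t : ℂ) - z)⁻¹ ∂σ = ∫ t : ℝ, ((t : ℂ) - z)⁻¹ ∂τ) :
    σ = τ := by
  refine ext_of_forall_integral_eq_of_IsFiniteMeasure fun f => ?_
  refine mul_left_cancel₀ Real.pi_ne_zero (tendsto_nhds_unique_of_eventuallyEq
    (tendsto_integral_integral_poisson σ f) (tendsto_integral_integral_poisson τ f) ?_)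
  filter_upwards [self_mem_nhdsWithin] with y (hy : 0 < y)
  rw [← integral_mul_im_stieltjes σ f hy, ← integral_mul_im_stieltjes τ f hy]
  refine integral_congr_ae (Eventually.of_forall fun x => ?_)
  simp only
  rw [h _ (by simpa using hy)]

end StieltjesInversion

/-! ### Uniqueness -/

section Uniqueness

open Filter Topology

/-- Stieltjes transforms that agree on the upper half plane off `i` also agree at `i`. -/
theorem stieltjes_eq_of_eq_off_I {σ τ : Measure ℝ} [IsFiniteMeasure σ] [IsFiniteMeasure τ]
    (h : ∀ z : ℂ, 0 < z.im → z ≠ Complex.I →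
      ∫ t : ℝ, ((t : ℂ) - z)⁻¹ ∂σ = ∫ t : ℝ, ((t : ℂ) - z)⁻¹ ∂τ) (z : ℂ) (hz : 0 < z.im) :
    ∫ t : ℝ, ((t : ℂ) - z)⁻¹ ∂σ = ∫ t : ℝ, ((t : ℂ) - z)⁻¹ ∂τ := by
  by_cases hzI : z = Complex.I
  swap
  · exact h z hz hzI
  have hopen : IsOpen {w : ℂ | w.im ≠ 0} := isOpen_ne_fun Complex.continuous_im continuous_const
  have hc (ρ : Measure ℝ) [IsFiniteMeasure ρ] :
      Tendsto (fun w : ℂ => ∫ t : ℝ, ((t : ℂ) - w)⁻¹ ∂ρ) (𝓝[≠] z)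
        (𝓝 (∫ t : ℝ, ((t : ℂ) - z)⁻¹ ∂ρ)) :=
    ((differentiableOn_integral_inv_ofReal_sub ρ).continuousOn.continuousAt
      (hopen.mem_nhds hz.ne')).mono_left nhdsWithin_le_nhds
  refine tendsto_nhds_unique_of_eventuallyEq (hc σ) (hc τ) ?_
  have hpos : ∀ᶠ w in 𝓝[≠] z, 0 < w.im :=
    nhdsWithin_le_nhds ((isOpen_lt continuous_const Complex.continuous_im).mem_nhds hz)
  filter_upwards [hpos, self_mem_nhdsWithin] with w hw hne
  exact h w hw (hzI ▸ hne)

theorem integralRep_unique_real {a b : ℝ} {σ τ : Measure ℝ} [IsFiniteMeasure σ]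
    [IsFiniteMeasure τ]
    (h : ∀ z : ℂ, z.im ≠ 0 → (a : ℂ) + b * z + (1 / (Real.pi : ℂ)) *
      (∫ t, herglotzKernel z t ∂σ - ∫ t, herglotzKernel z t ∂τ) = 0) :
    a = 0 ∧ b = 0 ∧ σ = τ := by
  have hpi : (Real.pi : ℂ) ≠ 0 := by exact_mod_cast Real.pi_ne_zero
  -- At z = i the factor 1 + z² vanishes and the kernel is constantly i, so the real part gives a =
  -- 0 and the imaginary part ties b to the masses.
  have hI := h Complex.I (by simp)
  simp only [integral_herglotzKernel_eq _ (show Complex.I.im ≠ 0 by simp), Complex.I_sq,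
    add_neg_cancel, zero_mul, add_zero] at hI
  have hI' : (a : ℂ) + ((b + (1 / Real.pi) * (σ.real Set.univ - τ.real Set.univ) : ℝ) : ℂ) *
      Complex.I = 0 := by
    rw [← hI]; push_cast; ring
  have ha : a = 0 := by simpa using congrArg Complex.re hI'
  have hb : b + (1 / Real.pi) * (σ.real Set.univ - τ.real Set.univ) = 0 := by
    simpa using congrArg Complex.im hI'
  have hb' : (b : ℂ) + (1 / (Real.pi : ℂ)) * (σ.real Set.univ - τ.real Set.univ) = 0 := by
    exact_mod_cast congrArg Complex.ofReal hb
  have hst : σ = τ := by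
    -- The argument divides by 1 + z², whose only zero in the upper half plane is i.
    refine Measure.ext_of_stieltjes_eq (stieltjes_eq_of_eq_off_I fun z hz hzI => ?_)
    have hz' := h z hz.ne'
    rw [integral_herglotzKernel_eq σ hz.ne', integral_herglotzKernel_eq τ hz.ne', ha] at hz'
    have h1 : (1 / (Real.pi : ℂ)) * (1 + z ^ 2) *
        (∫ t : ℝ, ((t : ℂ) - z)⁻¹ ∂σ - ∫ t : ℝ, ((t : ℂ) - z)⁻¹ ∂τ) = 0 := by
      push_cast at hz'
      linear_combination hz' - z * hb'
    have h2 : (1 : ℂ) + z ^ 2 ≠ 0 := by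
      intro h0
      have : (z - Complex.I) * (z + Complex.I) = 0 := by
        linear_combination h0 - Complex.I_sq
      rcases mul_eq_zero.1 this with h3 | h3
      · exact hzI (sub_eq_zero.1 h3)
      · have := congrArg Complex.im h3
        simp at this
        linarith
    simpa [hpi, h2, sub_eq_zero] using h1
  refine ⟨ha, ?_, hst⟩
  simpa [hst] using hb

theorem HasIntegralRep.unique {q : ℂ → ℂ} {a b a' b' : ℂ} {ν ν' : ComplexMeasure ℝ}
    (h : HasIntegralRep q a b ν) (h' : HasIntegralRep q a' b' ν') :
    a = a' ∧ b = b' ∧ ν = ν' := by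
  obtain ⟨σ₁, σ₂, σ₃, σ₄, _, _, _, _, hσ⟩ := exists_eq_complexMeasureOfFour (ν - ν')
  have hint (σ : Measure ℝ) [IsFiniteMeasure σ] {z : ℂ} (hz : z.im ≠ 0) :=
    integrable_herglotzKernel_measure σ hz
  have key (z : ℂ) (hz : z.im ≠ 0) : (a - a') + (b - b') * z + (1 / (Real.pi : ℂ)) *
      ((∫ t, herglotzKernel z t ∂σ₁ - ∫ t, herglotzKernel z t ∂σ₂) +
        Complex.I * (∫ t, herglotzKernel z t ∂σ₃ - ∫ t, herglotzKernel z t ∂σ₄)) = 0 := by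
    rw [← complexIntegral_complexMeasureOfFour (hint _ hz) (hint _ hz) (hint _ hz) (hint _ hz),
      ← hσ, complexIntegral, VectorMeasure.integral_sub_vectorMeasure
        (integrable_herglotzKernel ν hz) (integrable_herglotzKernel ν' hz)]
    have h1 := h z hz
    rw [h' z hz] at h1
    unfold complexIntegral at h1
    linear_combination -h1
  -- Conjugating the relation at conj z fixes the four integrals and conjugates only the
  -- coefficients; half the sum and the difference over 2i then give two real problems.
  have keyc (z : ℂ) (hz : z.im ≠ 0) := congrArg (starRingEnd ℂ)
    (key ((starRingEnd ℂ) z) (by simpa using hz))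
  simp only [map_add, map_sub, map_mul, map_div₀, map_one, Complex.conj_ofReal, Complex.conj_conj,
    conj_integral_herglotzKernel, Complex.conj_I, map_zero] at keyc
  have hre : (a - a').re = 0 ∧ (b - b').re = 0 ∧ σ₁ = σ₂ := by
    refine integralRep_unique_real fun z hz => ?_
    rw [Complex.re_eq_add_conj, Complex.re_eq_add_conj, map_sub, map_sub]
    linear_combination (key z hz + keyc z hz) / 2
  have him : (a - a').im = 0 ∧ (b - b').im = 0 ∧ σ₃ = σ₄ := by
    refine integralRep_unique_real fun z hz => ?_
    rw [Complex.im_eq_sub_conj, Complex.im_eq_sub_conj, map_sub, map_sub]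
    have hdiv (w : ℂ) : w / (2 * Complex.I) = -Complex.I / 2 * w := by
      field_simp
      rw [Complex.I_sq]
      ring
    rw [hdiv, hdiv]
    linear_combination (-Complex.I / 2) * (key z hz - keyc z hz) +
      (1 / (Real.pi : ℂ)) * (∫ t, herglotzKernel z t ∂σ₃ - ∫ t, herglotzKernel z t ∂σ₄) *
        Complex.I_sq
  obtain ⟨ha, hb, rfl⟩ := hre
  obtain ⟨ha', hb', rfl⟩ := him
  refine ⟨sub_eq_zero.1 (Complex.ext ha ha'), sub_eq_zero.1 (Complex.ext hb hb'),
    sub_eq_zero.1 (hσ.trans ?_)⟩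
  simp [complexMeasureOfFour_eq_sum_scaledComplexMeasure]

end Uniqueness

/-! ### The Schwarz formula on the unit disk -/

section SchwarzFormula

open Metric Real

theorem conj_circleAverage {f : ℂ → ℂ} {c : ℂ} {R : ℝ} (hf : CircleIntegrable f c R) :
    (starRingEnd ℂ) (circleAverage f c R) = circleAverage (fun z => (starRingEnd ℂ) (f z)) c R :=
  ((Complex.conjCLE : ℂ →L[ℝ] ℂ).circleAverage_comp_comm hf).symm

/-- The Schwarz integral formula on the unit disk: a holomorphic function is recovered from the
boundary values of its real part. -/
theorem circleAverage_herglotzRieszKernel_mul_re {g : ℂ → ℂ} {w : ℂ}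
    (hg : DiffContOnCl ℂ g (ball 0 1)) (hw : w ∈ ball (0 : ℂ) 1) :
    circleAverage (fun z => herglotzRieszKernel 0 w z * ((g z).re : ℂ)) 0 1 =
      g w - Complex.I * (g 0).im := by
  have hw' : ‖w‖ < 1 := by simpa using hw
  have hgc : ContinuousOn g (sphere 0 1) :=
    hg.2.mono (sphere_subset_closedBall.trans_eq (closure_ball 0 one_ne_zero).symm)
  have hne : ∀ z ∈ sphere (0 : ℂ) 1, z - w ≠ 0 := by
    rintro z hz h
    rw [sub_eq_zero] at h
    rw [mem_sphere_zero_iff_norm, h] at hz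
    exact hw'.ne hz
  have hne' : ∀ z ∈ closedBall (0 : ℂ) 1, 1 - (starRingEnd ℂ) w * z ≠ 0 := by
    intro z hz h
    have hz1 : ‖z‖ ≤ 1 := by simpa using hz
    have h1 : ‖(starRingEnd ℂ) w * z‖ = 1 := by rw [← sub_eq_zero.1 h, norm_one]
    rw [norm_mul, RCLike.norm_conj] at h1
    nlinarith [norm_nonneg z, norm_nonneg w]
  have hinvc : ContinuousOn (fun z => z / (z - w)) (sphere (0 : ℂ) 1) :=
    continuousOn_id.div (by fun_prop) hne
  have hconjc : ContinuousOn (fun z => (starRingEnd ℂ) (g z)) (sphere 0 1) :=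
    Complex.continuous_conj.comp_continuousOn hgc
  have A : circleAverage (fun z => z / (z - w) * g z) 0 1 = g w := by
    have h := DiffContOnCl.circleAverage_smul_div (R := 1) (c := 0) (w := w) (f := g)
      (by simpa using hg) (by simpa using hw')
    simpa using h
  have hdc : DiffContOnCl ℂ (fun z => (1 - (starRingEnd ℂ) w * z)⁻¹ • g z) (ball 0 1) := by
    refine DiffContOnCl.smul (DifferentiableOn.diffContOnCl ?_) hg
    rw [closure_ball 0 one_ne_zero]
    exact DifferentiableOn.inv (by fun_prop) hne'
  -- On the circle conj z = 1/z, so z/(z - w) is the conjugate of 1/(1 - conj w · z), which is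
  -- holomorphic in the disk; the mean value property applies to the conjugated integrand.
  have B : circleAverage (fun z => z / (z - w) * (starRingEnd ℂ) (g z)) 0 1 =
      (starRingEnd ℂ) (g 0) := by
    have h := DiffContOnCl.circleAverage (R := 1) (c := 0)
      (f := fun z => (1 - (starRingEnd ℂ) w * z)⁻¹ • g z) (by simpa using hdc)
    simp only [mul_zero, sub_zero, inv_one, one_smul] at h
    rw [← h, conj_circleAverage]
    · refine circleAverage_congr_sphere fun z hz => ?_
      rw [abs_one] at hz
      have hzn : z * (starRingEnd ℂ) z = 1 := by
        rw [Complex.mul_conj, Complex.normSq_eq_norm_sq, mem_sphere_zero_iff_norm.1 hz]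
        simp
      have h1 := hne z hz
      have h2 : 1 - w * (starRingEnd ℂ) z ≠ 0 := by
        have := (map_ne_zero (starRingEnd ℂ)).2 (hne' z (sphere_subset_closedBall hz))
        simpa using this
      simp only [smul_eq_mul, map_mul, map_inv₀, map_sub, map_one, Complex.conj_conj]
      congr 1
      field_simp
      linear_combination -w * hzn
    · refine ContinuousOn.circleIntegrable zero_le_one ?_
      exact hdc.2.mono (sphere_subset_closedBall.trans_eq (closure_ball 0 one_ne_zero).symm)
  have C : circleAverage (fun z => g z + (starRingEnd ℂ) (g z)) 0 1 =
      g 0 + (starRingEnd ℂ) (g 0) := by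
    have hgi := hgc.circleIntegrable zero_le_one
    rw [circleAverage_fun_add hgi (hconjc.circleIntegrable zero_le_one), ← conj_circleAverage hgi]
    have h := DiffContOnCl.circleAverage (R := 1) (c := 0) (f := g) (by simpa using hg)
    rw [h]
  -- The kernel (z + w)/(z - w) is 2 z/(z - w) - 1, and Re g = (g + conj g)/2.
  have D : circleAverage (fun z => (z / (z - w) * g z + z / (z - w) * (starRingEnd ℂ) (g z)) -
      (1 / 2 : ℂ) • (g z + (starRingEnd ℂ) (g z))) 0 1 =
      (g w + (starRingEnd ℂ) (g 0)) - (1 / 2 : ℂ) • (g 0 + (starRingEnd ℂ) (g 0)) := by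
    have i1 : CircleIntegrable (fun z => z / (z - w) * g z) 0 1 :=
      (hinvc.mul hgc).circleIntegrable zero_le_one
    have i2 : CircleIntegrable (fun z => z / (z - w) * (starRingEnd ℂ) (g z)) 0 1 :=
      (hinvc.mul hconjc).circleIntegrable zero_le_one
    have i12 : CircleIntegrable
        (fun z => z / (z - w) * g z + z / (z - w) * (starRingEnd ℂ) (g z)) 0 1 := i1.add i2
    have i3 : CircleIntegrable (fun z => (1 / 2 : ℂ) • (g z + (starRingEnd ℂ) (g z))) 0 1 :=
      ((hgc.fun_add hconjc).const_smul (1 / 2 : ℂ)).circleIntegrable zero_le_one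
    rw [circleAverage_fun_sub i12 i3, circleAverage_fun_add i1 i2, A, B,
      circleAverage_fun_smul, C]
  have E : g w - Complex.I * (g 0).im =
      (g w + (starRingEnd ℂ) (g 0)) - (1 / 2 : ℂ) • (g 0 + (starRingEnd ℂ) (g 0)) := by
    apply Complex.ext <;> simp <;> ring
  rw [E, ← D]
  refine circleAverage_congr_sphere fun z hz => ?_
  rw [abs_one] at hz
  have h1 := hne z hz
  simp only [herglotzRieszKernel_def, sub_zero, Complex.re_eq_add_conj, smul_eq_mul]
  field_simp
  ring

end SchwarzFormula

/-! ### The Herglotz–Riesz representation on the disk -/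

section HerglotzRiesz

open Metric Real Filter Topology BoundedContinuousFunction Set

/-- A nonnegative continuous density on a circle, as a finite measure in the angle variable. -/
theorem exists_finiteMeasure_integral_eq_circleAverage {u : ℂ → ℝ}
    (hu : ContinuousOn u (sphere 0 1)) (hpos : ∀ z ∈ sphere (0 : ℂ) 1, 0 ≤ u z) :
    ∃ μ : FiniteMeasure ℝ, (μ.mass : ℝ) = circleAverage u 0 1 ∧ μ (Icc 0 (2 * π))ᶜ = 0 ∧
      ∀ F : ℂ → ℂ, ∫ θ, F (circleMap 0 1 θ) ∂(μ : Measure ℝ) =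
        circleAverage (fun z => F z * (u z : ℂ)) 0 1 := by
  have hmem (θ : ℝ) : circleMap 0 1 θ ∈ sphere (0 : ℂ) 1 := circleMap_mem_sphere _ zero_le_one θ
  have huc : Continuous fun θ : ℝ => u (circleMap 0 1 θ) :=
    hu.comp_continuous (continuous_circleMap 0 1) hmem
  set d : ℝ → NNReal := fun θ => ((2 * π)⁻¹ * u (circleMap 0 1 θ)).toNNReal with hd
  have hdc : Continuous d := continuous_real_toNNReal.comp (continuous_const.mul huc)
  have hdv (θ : ℝ) : (d θ : ℝ) = (2 * π)⁻¹ * u (circleMap 0 1 θ) :=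
    Real.coe_toNNReal _ (mul_nonneg (by positivity) (hpos _ (hmem θ)))
  set μ : Measure ℝ := (volume.restrict (Ioc 0 (2 * π))).withDensity (fun θ => (d θ : ENNReal))
    with hμ
  have hint (F : ℂ → ℂ) : ∫ θ, F (circleMap 0 1 θ) ∂μ =
      circleAverage (fun z => F z * (u z : ℂ)) 0 1 := by
    rw [hμ, integral_withDensity_eq_integral_smul hdc.measurable, circleAverage_def,
      intervalIntegral.integral_of_le (by positivity), ← integral_smul]
    refine integral_congr_ae (Eventually.of_forall fun θ => ?_)
    simp only [NNReal.smul_def, hdv, Complex.real_smul]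
    push_cast
    ring
  have hfin : IsFiniteMeasure μ := by
    refine isFiniteMeasure_withDensity ?_
    have : IntegrableOn (fun θ => (d θ : ℝ)) (Ioc 0 (2 * π)) :=
      ((NNReal.continuous_coe.comp hdc).integrableOn_Icc).mono_set Ioc_subset_Icc_self
    have h := this.2.ne
    simpa [HasFiniteIntegral, enorm_eq_nnnorm] using h
  refine ⟨⟨μ, hfin⟩, ?_, ?_, hint⟩
  · have h1 := hint 1
    have hui : CircleIntegrable u 0 1 := hu.circleIntegrable zero_le_one
    have h2 := Complex.ofRealCLM.circleAverage_comp_comm hui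
    simp only [Pi.one_apply, integral_const, one_mul, Complex.real_smul, mul_one] at h1
    have h3 : circleAverage (fun z => (u z : ℂ)) 0 1 = ((circleAverage u 0 1 : ℝ) : ℂ) := h2
    rw [h3] at h1
    exact_mod_cast h1
  · have h : μ (Icc 0 (2 * π))ᶜ = 0 := by
      refine withDensity_absolutelyContinuous _ _ ?_
      rw [Measure.restrict_apply measurableSet_Icc.compl]
      refine measure_mono_null ?_ measure_empty
      rintro θ ⟨h1, h2⟩
      exact h1 (Ioc_subset_Icc_self h2)
    exact (FiniteMeasure.null_iff_toMeasure_null (⟨μ, hfin⟩ : FiniteMeasure ℝ) _).2 h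

theorem circleMap_sub_ne_zero_of_mem_ball {w : ℂ} (hw : w ∈ ball (0 : ℂ) 1) (θ : ℝ) :
    circleMap 0 1 θ - w ≠ 0 :=
  sub_ne_zero.2 (circleMap_ne_mem_ball hw θ)

theorem continuous_herglotzRieszKernel_circleMap {w : ℂ} (hw : w ∈ ball (0 : ℂ) 1) :
    Continuous fun θ : ℝ => herglotzRieszKernel 0 w (circleMap 0 1 θ) := by
  simp only [herglotzRieszKernel_def, sub_zero]
  exact Continuous.div (by fun_prop) (by fun_prop) (circleMap_sub_ne_zero_of_mem_ball hw)

theorem norm_herglotzRieszKernel_circleMap_le {w : ℂ} (hw : w ∈ ball (0 : ℂ) 1) (θ : ℝ) :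
    ‖herglotzRieszKernel 0 w (circleMap 0 1 θ)‖ ≤ (1 + ‖w‖) / (1 - ‖w‖) := by
  have hw' : ‖w‖ < 1 := by simpa using hw
  have h1 : ‖circleMap 0 1 θ‖ = 1 := by simp
  rw [herglotzRieszKernel_def, sub_zero, sub_zero, norm_div]
  have h2 := norm_add_le (circleMap 0 1 θ) w
  have h3 := norm_sub_norm_le (circleMap 0 1 θ) w
  rw [h1] at h2 h3
  have : 0 < 1 - ‖w‖ := by linarith
  gcongr

/-- The Herglotz–Riesz representation theorem on the unit disk, with the representing measure in
the angle variable. -/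
theorem exists_measure_eq_integral_herglotzRieszKernel {f : ℂ → ℂ}
    (hf : DifferentiableOn ℂ f (ball 0 1)) (hpos : ∀ w ∈ ball (0 : ℂ) 1, 0 ≤ (f w).re) :
    ∃ μ : FiniteMeasure ℝ, ∀ w ∈ ball (0 : ℂ) 1, f w = Complex.I * (f 0).im +
      ∫ θ, herglotzRieszKernel 0 w (circleMap 0 1 θ) ∂(μ : Measure ℝ) := by
  -- f has no boundary values in general, so the Schwarz formula is applied to the dilations f(rₙ
  -- z).
  obtain ⟨r, -, hr, hrlim⟩ := exists_seq_strictMono_tendsto' (zero_lt_one (α := ℝ))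
  have hmaps (n : ℕ) : MapsTo (fun z : ℂ => (r n : ℂ) * z) (closedBall 0 1) (ball 0 1) := by
    intro z hz
    have hz1 : ‖z‖ ≤ 1 := by simpa using hz
    have := hr n
    rw [mem_ball_zero_iff, norm_mul, Complex.norm_real, Real.norm_of_nonneg this.1.le]
    nlinarith [this.1, this.2]
  have hdiff (n : ℕ) : DifferentiableOn ℂ (fun z => f (r n * z)) (closedBall 0 1) :=
    hf.comp (by fun_prop) (hmaps n)
  have hdc (n : ℕ) : DiffContOnCl ℂ (fun z => f (r n * z)) (ball 0 1) :=
    DifferentiableOn.diffContOnCl (by rw [closure_ball 0 one_ne_zero]; exact hdiff n)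
  have hcont (n : ℕ) : ContinuousOn (fun z => (f (r n * z)).re) (sphere 0 1) :=
    Complex.continuous_re.comp_continuousOn
      ((hdiff n).continuousOn.mono sphere_subset_closedBall)
  choose μ hmass hsupp hint using fun n => exists_finiteMeasure_integral_eq_circleAverage (hcont n)
    (fun z hz => hpos _ (hmaps n (sphere_subset_closedBall hz)))
  have hrep (n : ℕ) (w : ℂ) (hw : w ∈ ball (0 : ℂ) 1) :
      ∫ θ, herglotzRieszKernel 0 w (circleMap 0 1 θ) ∂(μ n : Measure ℝ) =
        f (r n * w) - Complex.I * (f 0).im := by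
    rw [hint n (herglotzRieszKernel 0 w),
      circleAverage_herglotzRieszKernel_mul_re (hdc n) hw, mul_zero]
  have hmass' (n : ℕ) : (μ n).mass = (f 0).re.toNNReal := by
    have hg : ContinuousOn (fun z => f (r n * z)) (sphere 0 1) :=
      (hdiff n).continuousOn.mono sphere_subset_closedBall
    have h1 := Complex.reCLM.circleAverage_comp_comm (hg.circleIntegrable zero_le_one)
    have h2 := DiffContOnCl.circleAverage (R := 1) (c := 0) (f := fun z => f (r n * z))
      (by simpa using hdc n)
    rw [h2, mul_zero] at h1
    have h3 : circleAverage (fun z => (f (r n * z)).re) 0 1 = (f 0).re := h1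
    rw [← NNReal.coe_inj, hmass n, h3, Real.coe_toNNReal _ (hpos 0 (by simp))]
  -- All μₙ have mass Re f(0) and live on one compact interval, so they stay in a weakly compact
  -- set; a limit along an ultrafilter replaces a convergent subsequence.
  obtain ⟨ρ, -, hρ⟩ := (isCompact_setOfPred_finiteMeasure_le_of_isCompact (f 0).re.toNNReal
    (isCompact_Icc (a := (0 : ℝ)) (b := 2 * π))).ultrafilter_le_nhds
    ((hyperfilter ℕ).map μ) (by
      rw [le_principal_iff]
      exact Filter.mem_map.2 (Eventually.of_forall fun n => ⟨(hmass' n).le, hsupp n⟩))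
  have hρ' : Tendsto μ (hyperfilter ℕ) (𝓝 ρ) := hρ
  refine ⟨ρ, fun w hw => ?_⟩
  have hlim := (FiniteMeasure.tendsto_iff_forall_integral_rclike_tendsto ℂ).1 hρ'
    (BoundedContinuousFunction.ofNormedAddCommGroup _ (continuous_herglotzRieszKernel_circleMap hw)
      _ (norm_herglotzRieszKernel_circleMap_le hw))
  simp only [coe_ofNormedAddCommGroup, hrep _ w hw] at hlim
  have hlim' : Tendsto (fun n => f (r n * w) - Complex.I * (f 0).im) (hyperfilter ℕ)
      (𝓝 (f w - Complex.I * (f 0).im)) := by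
    refine Tendsto.sub_const ?_ _
    have h1 : Tendsto (fun n => (r n : ℂ) * w) atTop (𝓝 w) := by
      simpa using ((Complex.continuous_ofReal.tendsto 1).comp hrlim).mul_const w
    exact ((hf.continuousOn.continuousAt (isOpen_ball.mem_nhds hw)).tendsto.comp h1).mono_left
      Nat.hyperfilter_le_atTop
  rw [tendsto_nhds_unique hlim hlim']
  ring

end HerglotzRiesz

/-! ### The Cayley transform -/

section Cayley

open Metric

theorem one_sub_ne_zero_of_mem_ball {w : ℂ} (hw : w ∈ ball (0 : ℂ) 1) : 1 - w ≠ 0 := by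
  intro h
  rw [← sub_eq_zero.1 h] at hw
  simp at hw

theorem im_inverse_cayley_pos {w : ℂ} (hw : w ∈ ball (0 : ℂ) 1) :
    0 < (Complex.I * (1 + w) / (1 - w)).im := by
  have hn : 0 < Complex.normSq (1 - w) := Complex.normSq_pos.2 (one_sub_ne_zero_of_mem_ball hw)
  have hw' : Complex.normSq w < 1 := by
    rw [Complex.normSq_eq_norm_sq]
    have : ‖w‖ < 1 := by simpa using hw
    nlinarith [norm_nonneg w]
  rw [Complex.normSq_apply] at hw'
  have h : (Complex.I * (1 + w) / (1 - w)).im =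
      (1 - (w.re * w.re + w.im * w.im)) / Complex.normSq (1 - w) := by
    rw [Complex.div_im]
    simp
    ring
  rw [h]
  exact div_pos (by linarith) hn

theorem add_I_ne_zero_of_im_pos {z : ℂ} (hz : 0 < z.im) : z + Complex.I ≠ 0 := by
  intro h
  have := congrArg Complex.im h
  simp at this
  linarith

theorem cayley_mem_ball {z : ℂ} (hz : 0 < z.im) :
    (z - Complex.I) / (z + Complex.I) ∈ ball (0 : ℂ) 1 := by
  have h0 := norm_pos_iff.2 (add_I_ne_zero_of_im_pos hz)
  rw [mem_ball_zero_iff, norm_div, div_lt_one h0]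
  refine lt_of_pow_lt_pow_left₀ 2 h0.le ?_
  rw [← Complex.normSq_eq_norm_sq, ← Complex.normSq_eq_norm_sq, Complex.normSq_apply,
    Complex.normSq_apply]
  simp
  nlinarith

theorem inverse_cayley_cayley {z : ℂ} (hz : 0 < z.im) :
    Complex.I * (1 + (z - Complex.I) / (z + Complex.I)) /
      (1 - (z - Complex.I) / (z + Complex.I)) = z := by
  have h0 := add_I_ne_zero_of_im_pos hz
  have hI := Complex.I_ne_zero
  have h1 : 1 - (z - Complex.I) / (z + Complex.I) = 2 * Complex.I / (z + Complex.I) := by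
    field_simp
    ring
  rw [h1]
  field_simp
  ring

/-- The boundary point 1 corresponds to ∞ on the line; this value produces the linear term. -/
theorem herglotzRieszKernel_cayley_one {z : ℂ} (hz : 0 < z.im) :
    herglotzRieszKernel 0 ((z - Complex.I) / (z + Complex.I)) 1 = -Complex.I * z := by
  conv_rhs => rw [← inverse_cayley_cayley hz]
  rw [herglotzRieszKernel_def, sub_zero, sub_zero]
  linear_combination ((1 + (z - Complex.I) / (z + Complex.I)) /
      (1 - (z - Complex.I) / (z + Complex.I))) * Complex.I_sq

/-- The boundary correspondence of the inverse Cayley transform. -/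
noncomputable def lineOfCircle (ζ : ℂ) : ℝ := (Complex.I * (1 + ζ) / (1 - ζ)).re

/-- The inverse Cayley transform is real on the circle. At ζ = 1 both sides are 0, by the convention
for division by zero. -/
theorem ofReal_lineOfCircle {ζ : ℂ} (hζ : ‖ζ‖ = 1) :
    (lineOfCircle ζ : ℂ) = Complex.I * (1 + ζ) / (1 - ζ) := by
  refine Complex.ext (by simp [lineOfCircle]) ?_
  have h : ζ.re * ζ.re + ζ.im * ζ.im = 1 := by
    rw [← Complex.normSq_apply, Complex.normSq_eq_norm_sq, hζ, one_pow]
  have h2 : (Complex.I * (1 + ζ) / (1 - ζ)).im =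
      (1 - (ζ.re * ζ.re + ζ.im * ζ.im)) / Complex.normSq (1 - ζ) := by
    rw [Complex.div_im]
    simp
    ring
  rw [h2, h]
  simp

theorem herglotzRieszKernel_cayley {z ζ : ℂ} (hz : 0 < z.im) (hζ : ‖ζ‖ = 1) (hζ1 : ζ ≠ 1) :
    herglotzRieszKernel 0 ((z - Complex.I) / (z + Complex.I)) ζ =
      -Complex.I * herglotzKernel z (lineOfCircle ζ) := by
  have h0 := add_I_ne_zero_of_im_pos hz
  have hI := Complex.I_ne_zero
  have h1 : 1 - ζ ≠ 0 := sub_ne_zero.2 hζ1.symm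
  have h2 := ofReal_sub_ne_zero_of_im_ne_zero hz.ne' (lineOfCircle ζ)
  have h3 : ζ - (z - Complex.I) / (z + Complex.I) ≠ 0 := by
    intro h
    have hb := cayley_mem_ball hz
    rw [← sub_eq_zero.1 h, mem_ball_zero_iff, hζ] at hb
    exact lt_irrefl _ hb
  rw [herglotzRieszKernel_def, herglotzKernel, sub_zero, sub_zero, ← mul_div_assoc,
    div_eq_div_iff h3 h2, ofReal_lineOfCircle hζ]
  field_simp
  linear_combination (2 * ζ * z * Complex.I + ζ ^ 2 * z * Complex.I + ζ ^ 2 * z ^ 2 +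
    z * Complex.I - z ^ 2) * Complex.I_sq

end Cayley

/-! ### The Nevanlinna representation and the theorem -/

section HerglotzNevanlinna

open Metric Set Filter

theorem IsHerglotz.exists_measure_upper {h : ℂ → ℂ} (hh : IsHerglotz h) :
    ∃ (a b : ℝ) (σ : Measure ℝ) (_ : IsFiniteMeasure σ), ∀ z : ℂ, 0 < z.im →
      h z = a + b * z + ∫ t, herglotzKernel z t ∂σ := by
  have hmaps : MapsTo (fun w : ℂ => Complex.I * (1 + w) / (1 - w)) (ball 0 1)
      {z : ℂ | z.im ≠ 0} := fun w hw => (im_inverse_cayley_pos hw).ne'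
  have hf : DifferentiableOn ℂ
      (fun w => -Complex.I * h (Complex.I * (1 + w) / (1 - w))) (ball 0 1) := by
    refine DifferentiableOn.const_mul (hh.1.comp ?_ hmaps) _
    exact DifferentiableOn.div (by fun_prop) (by fun_prop) fun w hw =>
      one_sub_ne_zero_of_mem_ball hw
  have hpos : ∀ w ∈ ball (0 : ℂ) 1,
      0 ≤ (-Complex.I * h (Complex.I * (1 + w) / (1 - w))).re := by
    intro w hw
    have hw' := im_inverse_cayley_pos hw
    have h1 := (hh.2 _ hw'.ne').1
    have h2 := mul_nonneg h1 hw'.le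
    rw [div_mul_cancel₀ _ hw'.ne'] at h2
    simpa using h2
  obtain ⟨μ, hμ⟩ := exists_measure_eq_integral_herglotzRieszKernel hf hpos
  set α : ℝ := (-Complex.I * h (Complex.I * (1 + 0) / (1 - 0))).im
  set S : Set ℝ := {θ | circleMap 0 1 θ = 1}
  have hS : MeasurableSet S := (isClosed_eq (continuous_circleMap 0 1) continuous_const).measurableSet
  have hT : Measurable fun θ => lineOfCircle (circleMap 0 1 θ) := by
    unfold lineOfCircle
    have := (continuous_circleMap 0 1).measurable
    fun_prop
  -- Here -α = Re h(i), the slope is the mass of the angles over 1, and σ is the image on the line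
  -- of the remaining mass.
  refine ⟨-α, (μ : Measure ℝ).real S,
    ((μ : Measure ℝ).restrict Sᶜ).map (fun θ => lineOfCircle (circleMap 0 1 θ)),
    inferInstance, fun z hz => ?_⟩
  have hw := cayley_mem_ball hz
  have h1 := hμ _ hw
  have hint : Integrable (fun θ => herglotzRieszKernel 0 ((z - Complex.I) / (z + Complex.I))
      (circleMap 0 1 θ)) (μ : Measure ℝ) :=
    Integrable.of_bound (continuous_herglotzRieszKernel_circleMap hw).aestronglyMeasurable _
      (Eventually.of_forall (norm_herglotzRieszKernel_circleMap_le hw))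
  have hkc : Continuous (herglotzKernel z) :=
    Continuous.div (by fun_prop) (by fun_prop) (ofReal_sub_ne_zero_of_im_ne_zero hz.ne')
  rw [inverse_cayley_cayley hz, ← integral_add_compl hS hint,
    setIntegral_congr_fun hS (g := fun _ => -Complex.I * z) (fun θ (hθ : circleMap 0 1 θ = 1) => by
      simp only [hθ, herglotzRieszKernel_cayley_one hz]),
    setIntegral_congr_fun hS.compl
      (g := fun θ => -Complex.I * herglotzKernel z (lineOfCircle (circleMap 0 1 θ)))
      (fun θ hθ => herglotzRieszKernel_cayley hz (by simp) hθ),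
    setIntegral_const, integral_const_mul, Complex.real_smul] at h1
  rw [integral_map hT.aemeasurable hkc.aestronglyMeasurable]
  push_cast
  linear_combination Complex.I * h1 + (h z + α - z * (μ : Measure ℝ).real S -
    ∫ θ in Sᶜ, herglotzKernel z (lineOfCircle (circleMap 0 1 θ)) ∂(μ : Measure ℝ)) *
      Complex.I_sq

/-- The Nevanlinna integral representation of a Herglotz function. -/
theorem IsHerglotz.exists_integralRep {h : ℂ → ℂ} (hh : IsHerglotz h) :
    ∃ (a b : ℝ) (σ : Measure ℝ) (_ : IsFiniteMeasure σ), ∀ z : ℂ, z.im ≠ 0 →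
      h z = a + b * z + (1 / (Real.pi : ℂ)) * ∫ t, herglotzKernel z t ∂σ := by
  obtain ⟨a, b, σ, _, hσ⟩ := hh.exists_measure_upper
  -- Scaling σ by π absorbs the prefactor 1/π; the lower half plane then follows by conjugation
  -- symmetry.
  refine ⟨a, b, Real.pi.toNNReal • σ, inferInstance, fun z hz => ?_⟩
  have hpi : (Real.pi : ℂ) ≠ 0 := by exact_mod_cast Real.pi_ne_zero
  have hscale : (1 / (Real.pi : ℂ)) * ∫ t, herglotzKernel z t ∂(Real.pi.toNNReal • σ) =
      ∫ t, herglotzKernel z t ∂σ := by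
    rw [integral_smul_nnreal_measure, NNReal.smul_def, Real.coe_toNNReal _ Real.pi_pos.le,
      Complex.real_smul]
    field_simp
  rw [hscale]
  rcases lt_or_gt_of_ne hz with hneg | hpos
  · have h1 := hσ ((starRingEnd ℂ) z) (by simpa using hneg)
    rw [← (hh.2 z hz).2] at h1
    have h2 := congrArg (starRingEnd ℂ) h1
    simpa [conj_integral_herglotzKernel] using h2
  · exact hσ z hpos

theorem IsQuasiHerglotz.exists_hasIntegralRep {q : ℂ → ℂ} (hq : IsQuasiHerglotz q) :
    ∃ (a b : ℂ) (ν : ComplexMeasure ℝ), HasIntegralRep q a b ν := by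
  obtain ⟨h₁, h₂, h₃, h₄, hh₁, hh₂, hh₃, hh₄, hq⟩ := hq
  obtain ⟨a₁, b₁, σ₁, _, r₁⟩ := hh₁.exists_integralRep
  obtain ⟨a₂, b₂, σ₂, _, r₂⟩ := hh₂.exists_integralRep
  obtain ⟨a₃, b₃, σ₃, _, r₃⟩ := hh₃.exists_integralRep
  obtain ⟨a₄, b₄, σ₄, _, r₄⟩ := hh₄.exists_integralRep
  refine ⟨(a₁ - a₂) + Complex.I * (a₃ - a₄), (b₁ - b₂) + Complex.I * (b₃ - b₄),
    complexMeasureOfFour σ₁ σ₂ σ₃ σ₄, fun z hz => ?_⟩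
  have hint (σ : Measure ℝ) [IsFiniteMeasure σ] := integrable_herglotzKernel_measure σ hz
  rw [hq z hz, r₁ z hz, r₂ z hz, r₃ z hz, r₄ z hz,
    complexIntegral_complexMeasureOfFour (hint _) (hint _) (hint _) (hint _)]
  ring

end HerglotzNevanlinna

theorem mainTheorem1 (q : ℂ → ℂ) :
    (IsQuasiHerglotz q ↔
      ∃ (a b : ℂ) (ν : ComplexMeasure ℝ), HasIntegralRep q a b ν) ∧
    (∀ (a b a' b' : ℂ) (ν ν' : ComplexMeasure ℝ),
      HasIntegralRep q a b ν → HasIntegralRep q a' b' ν' →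
        a = a' ∧ b = b' ∧ ν = ν') :=
  ⟨⟨fun hq => hq.exists_hasIntegralRep, fun ⟨_, _, _, h⟩ => h.isQuasiHerglotz⟩,
    fun _ _ _ _ _ _ h h' => h.unique h'⟩
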